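/- Let $m,n,a,b,h\ge 0$ be integers and $F$ a field. A code instantiating the topology $T_{m\times n}(a,b,h)$ over $F$ is the set of all arrays $(c_{ij})\in F^{m\times n}$ satisfying $$\sum_{i=1}^m\alpha^{(k)}_i c_{ij}=0\ (j\in[n],k\in[a]),\qquad \sum_{j=1}^n\beta^{(k)}_j c_{ij}=0\ (i\in[m],k\in[b]),\qquad \sum_{i=1}^m\sum_{j=1}^n\gamma^{(k)}_{ij}c_{ij}=0\ (k\in[h]),$$ for some coefficients $\alpha^{(k)}_i,\beta^{(k)}_j,\gamma^{(k)}_{ij}\in F$. A code corrects an erasure pattern $E\subseteq[m]\times[n]$ if each codeword is determined by its entries outside $E$; the pattern $E$ is correctable for $T_{m\times n}(a,b,h)$ if some code instantiating this topology, over some finite field, corrects it. A code instantiating $T_{m\times n}(a,b,h)$ is maximally recoverable (MR) if it corrects every erasure pattern that is correctable for $T_{m\times n}(a,b,h)$. **Theorem.** Let $m,n,b\ge 1$ be integers and put $$C_0(m,b)=(m+1)!\cdot\binom{m\cdot b(m-1)}{\le 2b(m-1)},\qquad \binom{N}{\le r}=\sum_{i=0}^{r}\binom{N}{i}.$$ Then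 for every prime power $q\ge C_0(m,b)\cdot n^{2b(m-1)}+n^{b-1}$ there exists an MR code over $\mathbb F_q$ that instantiates the topology $T_{m\times n}(1,b,0)$. -/

import Mathlib

open scoped Nat

namespace GridTopology

/-- The code with column parities `α`, row parities `β` and global parities `γ`:
all `m × n` arrays over `F` that satisfy the `a` equations on every column, the `b` equations
on every row and the `h` global equations. -/
def gridCode {F : Type*} [Field F] {m n a b h : ℕ} (α : Fin a → Fin m → F)
    (β : Fin b → Fin n → F) (γ : Fin h → Fin m → Fin n → F) :
    Submodule F (Matrix (Fin m) (Fin n) F) where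
  carrier := {c | (∀ k j, ∑ i, α k i * c i j = 0) ∧ (∀ k i, ∑ j, β k j * c i j = 0) ∧
    ∀ k, ∑ i, ∑ j, γ k i j * c i j = 0}
  zero_mem' := by simp
  add_mem' := by
    rintro c d ⟨h1, h2, h3⟩ ⟨h4, h5, h6⟩
    refine ⟨fun k j => ?_, fun k i => ?_, fun k => ?_⟩
    · simp [mul_add, Finset.sum_add_distrib, h1, h4]
    · simp [mul_add, Finset.sum_add_distrib, h2, h5]
    · simp [mul_add, Finset.sum_add_distrib, h3, h6]
  smul_mem' := by
    rintro r c ⟨h1, h2, h3⟩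
    refine ⟨fun k j => ?_, fun k i => ?_, fun k => ?_⟩
    · simp [mul_left_comm _ r, ← Finset.mul_sum, h1]
    · simp [mul_left_comm _ r, ← Finset.mul_sum, h2]
    · simp [mul_left_comm _ r, ← Finset.mul_sum, h3]

/-- `C` instantiates the topology `T_{m×n}(a,b,h)` over `F`. -/
def Instantiates {F : Type*} [Field F] {m n : ℕ} (a b h : ℕ)
    (C : Submodule F (Matrix (Fin m) (Fin n) F)) : Prop :=
  ∃ (α : Fin a → Fin m → F) (β : Fin b → Fin n → F) (γ : Fin h → Fin m → Fin n → F),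
    C = gridCode α β γ

/-- `C` corrects the erasure pattern `E`: a codeword is determined by its entries outside `E`. -/
def Corrects {F : Type*} [Field F] {m n : ℕ} (C : Submodule F (Matrix (Fin m) (Fin n) F))
    (E : Finset (Fin m × Fin n)) : Prop :=
  ∀ c ∈ C, ∀ d ∈ C, (∀ i j, (i, j) ∉ E → c i j = d i j) → c = d

/-- `E` is correctable for the topology `T_{m×n}(a,b,h)`: some code instantiating the topology,
over some finite field, corrects `E`. (Every finite field is isomorphic to one in `Type`.) -/
def IsCorrectable {m n : ℕ} (a b h : ℕ) (E : Finset (Fin m × Fin n)) : Prop :=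
  ∃ (K : Type) (_ : Field K) (_ : Finite K) (C : Submodule K (Matrix (Fin m) (Fin n) K)),
    Instantiates a b h C ∧ Corrects C E

/-- `C` is a maximally recoverable code instantiating `T_{m×n}(a,b,h)`. -/
def IsMR {F : Type*} [Field F] {m n : ℕ} (a b h : ℕ)
    (C : Submodule F (Matrix (Fin m) (Fin n) F)) : Prop :=
  Instantiates a b h C ∧ ∀ E : Finset (Fin m × Fin n), IsCorrectable a b h E → Corrects C E

/-- `binom(N, ≤ r)`, the number of subsets of size at most `r` of an `N`-element set. -/
def binomLE (N r : ℕ) : ℕ := ∑ i ∈ Finset.range (r + 1), N.choose i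

/-- The constant `C₀(m,b) = (m+1)! · binom(m·b(m-1), ≤ 2b(m-1))`, for `m ≥ 1`. -/
def C₀ (m b : ℕ) : ℕ := (m + 1)! * binomLE (m * (b * (m - 1))) (2 * b * (m - 1))

end GridTopology

namespace GridTopology

open Finset Module

universe u

section Basic

variable {F : Type*} [Field F] {m n a b h : ℕ}

/-! A purely combinatorial condition governs correctability: a correctable pattern satisfies
`IsRegular` (`IsCorrectable.isRegular`). Conversely, a regular pattern is corrected by a code with
all column weights 1 and row checks over some extension of F (`IsRegular.exists_corrects`), namely a
row code whose generator matrix is generic subject to supports dictated by the pattern. Hence some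
maximal minor of the parity check matrix, as a polynomial in the row checks, is nonzero over F. Each
variable has degree at most m in it (`IsRegular.exists_polynomial`).

Not every correctable pattern needs its own polynomial. If correction fails, the support of a bad
codeword is itself regular, and zero column sums put at least two entries in each column that it
meets. Regularity then leaves at most b(m-1) columns and 2b(m-1) entries (`exists_small_pattern`).
The product of the polynomials over these small patterns has degree below q in each variable, so it
is nonzero at some point of F, which gives the row checks. -/

theorem mem_gridCode {α : Fin a → Fin m → F} {β : Fin b → Fin n → F}
    {γ : Fin h → Fin m → Fin n → F} {c : Matrix (Fin m) (Fin n) F} :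
    c ∈ gridCode α β γ ↔ (∀ k j, ∑ i, α k i * c i j = 0) ∧ (∀ k i, ∑ j, β k j * c i j = 0) ∧
      ∀ k, ∑ i, ∑ j, γ k i j * c i j = 0 := Iff.rfl

theorem corrects_iff {C : Submodule F (Matrix (Fin m) (Fin n) F)} {E : Finset (Fin m × Fin n)} :
    Corrects C E ↔ ∀ c ∈ C, (∀ i j, (i, j) ∉ E → c i j = 0) → c = 0 := by
  constructor
  · intro H c hc h0
    exact H c hc 0 C.zero_mem fun i j hij => by simpa using h0 i j hij
  · intro H c hc d hd h0
    refine sub_eq_zero.1 (H _ (C.sub_mem hc hd) fun i j hij => ?_)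
    simp [h0 i j hij]

theorem Corrects.mono {C : Submodule F (Matrix (Fin m) (Fin n) F)} {E E' : Finset (Fin m × Fin n)}
    (H : Corrects C E) (hE : E' ⊆ E) : Corrects C E' :=
  fun c hc d hd h0 => H c hc d hd fun i j hij => h0 i j fun h => hij (hE h)

theorem IsCorrectable.mono {E E' : Finset (Fin m × Fin n)} (H : IsCorrectable a b h E)
    (hE : E' ⊆ E) : IsCorrectable a b h E' := by
  obtain ⟨K, i1, i2, C, hC, hE'⟩ := H
  exact ⟨K, i1, i2, C, hC, hE'.mono hE⟩

end Basic

/-! ### Necessity of the counting condition -/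

/-- The counting condition on an erasure pattern for one column parity and `b` row parities. -/
def IsRegular {m n : ℕ} (b : ℕ) (E : Finset (Fin m × Fin n)) : Prop :=
  ∀ (U : Finset (Fin m)) (V : Finset (Fin n)), U.Nonempty → b ≤ #V →
    #(E ∩ U ×ˢ V) + b ≤ #V + b * #U

/-- Extend a family on `s` by zero. -/
def extendZero (K : Type*) [Field K] {ι W : Type*} [DecidableEq ι] [AddCommGroup W] [Module K W]
    (s : Finset ι) : (s → W) →ₗ[K] (ι → W) where
  toFun y j := if hj : j ∈ s then y ⟨j, hj⟩ else 0
  map_add' y z := by ext j; by_cases hj : j ∈ s <;> simp [hj]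
  map_smul' r y := by ext j; by_cases hj : j ∈ s <;> simp [hj]

/-- Replace the entry at `u` such that the sum with weights `α` vanishes (if `α u ≠ 0`). -/
def balance {K : Type*} [Field K] {ι W : Type*} [Fintype ι] [DecidableEq ι] [AddCommGroup W]
    [Module K W] (α : ι → K) (u : ι) : (ι → W) →ₗ[K] (ι → W) where
  toFun y i := if i = u then -(α u)⁻¹ • ∑ i', α i' • y i' else y i
  map_add' y z := by
    ext i
    by_cases hi : i = u <;> simp [hi, Finset.sum_add_distrib, smul_add]
  map_smul' r y := by
    ext i
    by_cases hi : i = u <;> simp [hi, Finset.smul_sum, smul_comm r]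

section

variable {K : Type*} [Field K] {ι W : Type*} [DecidableEq ι] [AddCommGroup W] [Module K W]

theorem extendZero_mem {s : Finset ι} {j : ι} (hj : j ∈ s) (y : s → W) :
    extendZero K s y j = y ⟨j, hj⟩ := by simp [extendZero, hj]

theorem extendZero_notMem {s : Finset ι} {j : ι} (hj : j ∉ s) (y : s → W) :
    extendZero K s y j = 0 := by simp [extendZero, hj]

theorem balance_self [Fintype ι] (α : ι → K) (u : ι) (y : ι → W) :
    balance α u y u = -(α u)⁻¹ • ∑ i, α i • y i := by simp [balance]

theorem balance_of_ne [Fintype ι] (α : ι → K) {u i : ι} (h : i ≠ u) (y : ι → W) :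
    balance α u y i = y i := by simp [balance, h]

end

/-- Words on V satisfying the row checks form a space of dimension at least #V - b. Fill all rows of
U but one with such words freely and let the last row repair the column parities. The resulting
codewords on U × V are determined by their entries outside E, so (#U - 1)(#V - b) is at most the
number of unerased cells of U × V. -/
theorem IsCorrectable.isRegular {m n b : ℕ} {E : Finset (Fin m × Fin n)}
    (H : IsCorrectable 1 b 0 E) : IsRegular b E := by
  classical
  obtain ⟨K, _, _, C, ⟨α, β, γ, rfl⟩, hE⟩ := H
  rw [corrects_iff] at hE
  intro U V hU hV
  -- The balancing row has nonzero weight if U has such a row. Otherwise the column parity is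
  -- trivial on U, and `balance` puts zero in row u because 0⁻¹ = 0.
  obtain ⟨u, huU, hu⟩ : ∃ u ∈ U, α 0 u = 0 → ∀ i ∈ U, α 0 i = 0 := by
    by_cases h : ∀ i ∈ U, α 0 i = 0
    · obtain ⟨u, hu⟩ := hU
      exact ⟨u, hu, fun _ => h⟩
    · push Not at h
      obtain ⟨u, hu, hu'⟩ := h
      exact ⟨u, hu, fun h => absurd h hu'⟩
  let ρ : (V → K) →ₗ[K] (Fin b → K) := Matrix.mulVecLin (Matrix.of β) ∘ₗ extendZero K V
  let N := LinearMap.ker ρ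
  have hN : #V - b ≤ finrank K N := by
    have h1 := ρ.finrank_range_add_finrank_ker
    have h2 := (LinearMap.range ρ).finrank_le
    simp only [finrank_fintype_fun_eq_card, Fintype.card_coe, Fintype.card_fin] at h1 h2
    change _ + finrank K N = _ at h1
    omega
  let ext : (↥(U.erase u) → N) →ₗ[K] (Fin m → Fin n → K) :=
    extendZero K (U.erase u) ∘ₗ (extendZero K V ∘ₗ N.subtype).compLeft _
  let Ψ : (↥(U.erase u) → N) →ₗ[K] (Fin m → Fin n → K) := balance (α 0) u ∘ₗ ext
  have hΨu : ∀ y j, Ψ y u j = -(α 0 u)⁻¹ * ∑ i, α 0 i * ext y i j := fun y j => by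
    simp [Ψ, balance_self]
  have hΨ : ∀ y i, i ≠ u → Ψ y i = ext y i := fun y i hi => balance_of_ne _ hi _
  have hextmem : ∀ y i (hi : i ∈ U.erase u), ext y i = extendZero K V (y ⟨i, hi⟩ : V → K) :=
    fun y i hi => extendZero_mem (K := K) hi _
  have hext0 : ∀ y i, i ∉ U.erase u → ext y i = 0 := fun y i hi => extendZero_notMem (K := K) hi _
  have hextu : ∀ y, ext y u = 0 := fun y => hext0 y u (by simp)
  have hextU : ∀ y i, i ∉ U → ext y i = 0 := fun y i hi => hext0 y i (by simp [hi])
  have hextV : ∀ y i j, j ∉ V → ext y i j = 0 := fun y i j hj => by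
    by_cases hi : i ∈ U.erase u
    · rw [hextmem y i hi, extendZero_notMem hj]
    · rw [hext0 y i hi, Pi.zero_apply]
  have hextβ : ∀ y i k, ∑ j, β k j * ext y i j = 0 := fun y i k => by
    by_cases hi : i ∈ U.erase u
    · rw [hextmem y i hi]
      exact congrFun (LinearMap.mem_ker.1 (y ⟨i, hi⟩).2) k
    · simp [hext0 y i hi]
  clear_value ext
  have hΨmem : ∀ y, (Ψ y : Matrix (Fin m) (Fin n) K) ∈ gridCode α β γ := by
    intro y
    refine mem_gridCode.2 ⟨fun k j => ?_, fun k i => ?_, fun k => k.elim0⟩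
    · obtain rfl : k = 0 := Subsingleton.elim _ _
      rw [← Finset.add_sum_erase _ _ (mem_univ u), hΨu]
      have h1 : ∑ i ∈ univ.erase u, α 0 i * Ψ y i j = ∑ i, α 0 i * ext y i j := by
        rw [← Finset.add_sum_erase _ _ (mem_univ u), hextu, Pi.zero_apply, mul_zero, zero_add]
        exact Finset.sum_congr rfl fun i hi => by rw [hΨ y i (mem_erase.1 hi).1]
      rw [h1]
      by_cases h0 : α 0 u = 0
      · rw [h0, zero_mul, zero_add]
        refine Finset.sum_eq_zero fun i _ => ?_
        by_cases hi : i ∈ U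
        · rw [hu h0 i hi, zero_mul]
        · rw [hextU y i hi, Pi.zero_apply, mul_zero]
      · rw [neg_mul, mul_neg, mul_inv_cancel_left₀ h0, neg_add_cancel]
    -- Row u is a linear combination of the other rows, so it inherits their checks.
    · by_cases hi : i = u
      · have : ∀ j, β k j * Ψ y i j = ∑ i', -(α 0 u)⁻¹ * α 0 i' * (β k j * ext y i' j) := by
          intro j
          rw [hi, hΨu, Finset.mul_sum, Finset.mul_sum]
          exact Finset.sum_congr rfl fun i' _ => by ring
        simp only [this]
        rw [Finset.sum_comm]
        simp [← Finset.mul_sum, hextβ]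
      · rw [hΨ y i hi]
        exact hextβ y i k
  let R : (Fin m → Fin n → K) →ₗ[K] (↥(U ×ˢ V \ E) → K) :=
    { toFun := fun c e => c e.1.1 e.1.2
      map_add' := fun _ _ => rfl
      map_smul' := fun _ _ => rfl }
  have hinj : Function.Injective (R ∘ₗ Ψ) := by
    rw [← LinearMap.ker_eq_bot, LinearMap.ker_eq_bot']
    intro y hy
    have h0 : Ψ y = 0 := by
      refine hE _ (hΨmem y) fun i j hij => ?_
      by_cases hi : i ∈ U
      · by_cases hj : j ∈ V
        · exact congrFun hy ⟨(i, j), by simp [hi, hj, hij]⟩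
        · by_cases hiu : i = u
          · rw [hiu, hΨu]
            simp [hextV y _ j hj]
          · rw [hΨ y i hiu, hextV y i j hj]
      · have hiu : i ≠ u := fun h => hi (h ▸ huU)
        rw [hΨ y i hiu, hextU y i hi, Pi.zero_apply]
    ext ⟨i, hi⟩ ⟨j, hj⟩
    have := congrFun (congrFun h0 i) j
    rwa [hΨ y i (mem_erase.1 hi).1, hextmem y i hi, extendZero_mem hj] at this
  have hdim := LinearMap.finrank_le_finrank_of_injective hinj
  rw [finrank_pi_fintype] at hdim
  simp only [finrank_fintype_fun_eq_card, Fintype.card_coe, Finset.sum_const, card_univ,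
    smul_eq_mul, card_erase_of_mem huU] at hdim
  have h1 : #(U ×ˢ V \ E) + #(E ∩ U ×ˢ V) = #U * #V := by
    rw [← card_product, Finset.inter_comm, Finset.card_sdiff_add_card_inter]
  have h2 : (#U - 1) * (#V - b) ≤ #(U ×ˢ V \ E) := (Nat.mul_le_mul_left _ hN).trans hdim
  have h3 : 1 ≤ #U := hU.card_pos
  obtain ⟨x, hx⟩ := Nat.exists_eq_add_of_le h3
  obtain ⟨z, hz⟩ := Nat.exists_eq_add_of_le hV
  rw [hx, hz] at h1 h2
  simp only [Nat.add_sub_cancel_left] at h2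
  rw [hx, hz]
  nlinarith

/-! ### Generic matrices with prescribed row supports -/

/-- The matrix with independent indeterminates in the positions of `T` and zeros elsewhere. -/
noncomputable def patternMatrix (F : Type*) [Field F] {ι κ : Type*} [DecidableEq κ]
    (T : ι → Finset κ) : Matrix ι κ (MvPolynomial (ι × κ) F) :=
  Matrix.of fun r j => if j ∈ T r then MvPolynomial.X (r, j) else 0

/-- Hall's theorem matches each row with an allowed column of the minor. Setting the matched
indeterminates to 1 and the others to 0 gives a permutation matrix, of determinant ±1. -/
theorem det_patternMatrix_submatrix_ne_zero (F : Type*) [Field F] {ι κ : Type*} [Fintype ι]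
    [DecidableEq ι] [DecidableEq κ] (T : ι → Finset κ) {e : ι → κ} (he : Function.Injective e)
    (hall : ∀ I : Finset ι, #I ≤ #(I.biUnion T ∩ univ.image e)) :
    ((patternMatrix F T).submatrix id e).det ≠ 0 := by
  obtain ⟨f, hf, hfT⟩ := (Finset.all_card_le_biUnion_card_iff_exists_injective
    fun r => T r ∩ univ.image e).1 (by simpa only [← Finset.biUnion_inter] using hall)
  choose s hs using fun r => (mem_image.1 (mem_inter.1 (hfT r)).2)
  have hsinj : Function.Injective s := fun x y hxy => hf (by rw [← (hs x).2, ← (hs y).2, hxy])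
  let σ : Equiv.Perm ι := Equiv.ofBijective s (Finite.injective_iff_bijective.1 hsinj)
  intro h0
  have h1 := congrArg (MvPolynomial.eval fun p : ι × κ => if p.2 = f p.1 then (1 : F) else 0) h0
  rw [RingHom.map_det, map_zero] at h1
  have h2 : (MvPolynomial.eval fun p : ι × κ => if p.2 = f p.1 then (1 : F) else 0).mapMatrix
      ((patternMatrix F T).submatrix id e) = (1 : Matrix ι ι F).submatrix σ id := by
    ext r r'
    have hr : e (s r) = f r := (hs r).2
    have hfr : f r ∈ T r := (mem_inter.1 (hfT r)).1
    have hiff : e r' = f r ↔ s r = r' := by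
      rw [← hr]; exact ⟨fun h => (he h).symm, fun h => by rw [h]⟩
    simp only [patternMatrix, RingHom.mapMatrix_apply, Matrix.map_apply, Matrix.submatrix_apply,
      id, Matrix.of_apply, Matrix.one_apply, σ, Equiv.ofBijective_apply]
    by_cases h : s r = r'
    · have := hiff.2 h
      simp [h, this, hfr]
    · have h' : ¬ e r' = f r := fun hh => h (hiff.1 hh)
      by_cases h3 : e r' ∈ T r <;> simp [h, h', h3]
  rw [h2, Matrix.det_permute, Matrix.det_one, mul_one] at h1
  exact (Units.map (Int.castRingHom F).toMonoidHom (Equiv.Perm.sign σ)).ne_zero h1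

/-- A matrix with prescribed row supports, all of whose maximal minors are nonzero. -/
theorem exists_matrix_maximal_minors_ne_zero (F : Type u) [Field F] {ι κ : Type} [Fintype ι]
    [DecidableEq ι] [Fintype κ] [DecidableEq κ] (T : ι → Finset κ) (b : ℕ)
    (hcard : Fintype.card κ ≤ Fintype.card ι + b)
    (hT : ∀ I : Finset ι, I.Nonempty → #I + b ≤ #(I.biUnion T)) :
    ∃ (K : Type u) (_ : Field K) (_ : Algebra F K) (G : Matrix ι κ K),
      (∀ r j, j ∉ T r → G r j = 0) ∧
      ∀ e : ι → κ, Function.Injective e → (G.submatrix id e).det ≠ 0 := by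
  refine ⟨FractionRing (MvPolynomial (ι × κ) F), inferInstance, inferInstance,
    (patternMatrix F T).map (algebraMap _ _), fun r j hj => by
      rw [Matrix.map_apply, patternMatrix, Matrix.of_apply, if_neg hj, map_zero],
    fun e he => ?_⟩
  -- A maximal minor omits at most b columns, which the surplus b in `hT` absorbs.
  have h := det_patternMatrix_submatrix_ne_zero F T he fun I => by
    rcases I.eq_empty_or_nonempty with rfl | hI
    · simp
    · have h1 := hT I hI
      have h2 : #(univ.image e) = Fintype.card ι := by rw [card_image_of_injective _ he, card_univ]
      have h3 := card_union_add_card_inter (I.biUnion T) (univ.image e)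
      have h4 := card_le_univ (I.biUnion T ∪ univ.image e)
      omega
  rw [Matrix.submatrix_map, ← RingHom.mapMatrix_apply, ← RingHom.map_det]
  exact fun h0 => h ((IsFractionRing.injective (MvPolynomial (ι × κ) F)
    (FractionRing (MvPolynomial (ι × κ) F))) (by rw [h0, map_zero]))

/-- A combination of the rows of `G` that vanishes outside `A` only involves the rows in `B`, if
those are supported on `A` and there are sufficiently many of them. -/
theorem eq_zero_of_vecMul_eq_zero_off {K : Type*} [Field K] {ι κ : Type*} [Fintype ι]
    [DecidableEq ι] [Fintype κ] [DecidableEq κ] (G : Matrix ι κ K)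
    (hG : ∀ e : ι → κ, Function.Injective e → (G.submatrix id e).det ≠ 0)
    (hcard : Fintype.card ι ≤ Fintype.card κ) (A : Finset κ) (B : Finset ι)
    (hB : ∀ r ∈ B, ∀ j ∉ A, G r j = 0) (hAB : Fintype.card ι + #A ≤ Fintype.card κ + #B)
    (x : ι → K) (hx : ∀ j ∉ A, (Matrix.vecMul x G) j = 0) : ∀ r ∉ B, x r = 0 := by
  -- Select columns so that rows outside B are matched with columns outside A. Rows in B vanish
  -- there, so the minor is block triangular and its block on the complement of B is invertible.
  obtain ⟨e, he, heA⟩ := (Finset.all_card_le_biUnion_card_iff_exists_injective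
    fun r => if r ∈ B then univ else Aᶜ).1 (by
      intro I
      by_cases hI : ∃ r ∈ I, r ∈ B
      · obtain ⟨r, hrI, hrB⟩ := hI
        have h1 : (univ : Finset κ) ⊆ I.biUnion fun r => if r ∈ B then univ else Aᶜ := by
          intro j _
          exact mem_biUnion.2 ⟨r, hrI, by simp [hrB]⟩
        exact (card_le_univ I).trans (hcard.trans (by simpa using card_le_card h1))
      · push Not at hI
        rcases I.eq_empty_or_nonempty with rfl | ⟨r, hr⟩
        · simp
        · have h1 : Aᶜ ⊆ I.biUnion fun r => if r ∈ B then univ else Aᶜ := by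
            intro j hj
            exact mem_biUnion.2 ⟨r, hr, by simpa [hI r hr] using hj⟩
          have h2 := card_le_card h1
          have h3 : #I ≤ #Bᶜ := card_le_card fun r hr => by simpa using hI r hr
          rw [card_compl] at h2 h3
          have := card_le_univ A
          have := card_le_univ B
          omega)
  have hdet := hG e he
  rw [Matrix.twoBlockTriangular_det' _ (fun r => r ∈ B)] at hdet
  · have h0 := Matrix.eq_zero_of_vecMul_eq_zero (right_ne_zero_of_mul hdet)
      (v := fun r => x r.1) (by
        ext ⟨r', hr'⟩
        have hA : e r' ∉ A := by simpa [hr'] using heA r'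
        have h1 := hx _ hA
        rw [Matrix.vecMul, dotProduct, ← Finset.sum_subset (subset_univ (univ.filter (· ∉ B)))
          fun r _ hr => by rw [hB r (by simpa using hr) _ hA, mul_zero]] at h1
        rw [Finset.sum_subtype (p := fun r => r ∉ B) _ (by simp)] at h1
        exact h1)
    exact fun r hr => congrFun h0 ⟨r, hr⟩
  · intro r hr r' hr'
    exact hB r hr _ (by simpa [hr'] using heA r')

/-! ### Sufficiency of the counting condition over an extension field -/

/-- A linear code of codimension at most `b` is cut out by `b` parity checks. -/
theorem exists_parity_checks {K : Type*} [Field K] {n b : ℕ} (W : Submodule K (Fin n → K))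
    (hW : n ≤ finrank K W + b) :
    ∃ β : Fin b → Fin n → K, ∀ v : Fin n → K, (∀ k, ∑ j, β k j * v j = 0) → v ∈ W := by
  have h1 := W.finrank_quotient_add_finrank
  rw [finrank_fin_fun] at h1
  obtain ⟨f, hf⟩ := (finrank_le_iff_exists_linearMap (R := K) (M := (Fin n → K) ⧸ W)
    (M' := Fin b → K)).1 (by rw [finrank_fin_fun]; omega)
  refine ⟨LinearMap.toMatrix' (f ∘ₗ W.mkQ), fun v hv => ?_⟩
  have h2 : (f ∘ₗ W.mkQ) v = 0 := by
    rw [← Matrix.toLin'_toMatrix' (f ∘ₗ W.mkQ)]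
    exact funext hv
  rw [← Submodule.Quotient.mk_eq_zero]
  exact hf (by simpa using h2)

/-- The code of all arrays with zero column sums whose rows satisfy the parity checks `β`. -/
def sumCode {F : Type*} [Field F] {m n b : ℕ} (β : Fin b → Fin n → F) :
    Submodule F (Matrix (Fin m) (Fin n) F) :=
  gridCode (a := 1) (h := 0) (fun _ _ => 1) β fun k => k.elim0

theorem mem_sumCode {F : Type*} [Field F] {m n b : ℕ} {β : Fin b → Fin n → F}
    {c : Matrix (Fin m) (Fin n) F} :
    c ∈ sumCode β ↔ (∀ j, ∑ i, c i j = 0) ∧ ∀ k i, ∑ j, β k j * c i j = 0 := by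
  simp [sumCode, mem_gridCode]

/-- The erased positions of row `i`. -/
def rowSet {m n : ℕ} (E : Finset (Fin m × Fin n)) (i : Fin m) : Finset (Fin n) :=
  univ.filter fun j => (i, j) ∈ E

theorem mem_rowSet {m n : ℕ} {E : Finset (Fin m × Fin n)} {i : Fin m} {j : Fin n} :
    j ∈ rowSet E i ↔ (i, j) ∈ E := by simp [rowSet]

/-- Regularity with V the union of the erased sets of the rows in U; it supplies the Hall-type
hypothesis for the generator matrix. -/
theorem IsRegular.sum_card_rowSet_le {m n b : ℕ} {E : Finset (Fin m × Fin n)} (hE : IsRegular b E)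
    {U : Finset (Fin m)} (hU : U.Nonempty) (hUb : ∀ i ∈ U, b ≤ #(rowSet E i)) :
    ∑ i ∈ U, (#(rowSet E i) - b) + b ≤ #(U.biUnion (rowSet E)) := by
  have hV : b ≤ #(U.biUnion (rowSet E)) := by
    obtain ⟨i, hi⟩ := hU
    exact (hUb i hi).trans (card_le_card (subset_biUnion_of_mem _ hi))
  have h := hE U _ hU hV
  have h1 : #(E ∩ U ×ˢ U.biUnion (rowSet E)) = ∑ i ∈ U, #(rowSet E i) := by
    rw [← Finset.card_sigma]
    refine Finset.card_bij' (fun p _ => ⟨p.1, p.2⟩) (fun p _ => (p.1, p.2)) ?_ ?_ ?_ ?_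
    · rintro ⟨i, j⟩ h
      simp only [mem_inter, mem_product] at h
      simp [mem_rowSet, h.1, h.2.1]
    · rintro ⟨i, j⟩ h
      simp only [mem_sigma, mem_rowSet] at h
      simp only [mem_inter, mem_product, mem_biUnion, mem_rowSet]
      exact ⟨h.2, h.1, i, h⟩
    · intros; rfl
    · intros; rfl
  have h2 : ∑ i ∈ U, (#(rowSet E i) - b) + b * #U = ∑ i ∈ U, #(rowSet E i) := by
    rw [mul_comm, ← smul_eq_mul, ← Finset.sum_const, ← Finset.sum_add_distrib]
    exact Finset.sum_congr rfl fun i hi => Nat.sub_add_cancel (hUb i hi)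
  omega

theorem IsRegular.sum_card_rowSet_univ_le {m n b : ℕ} {E : Finset (Fin m × Fin n)}
    (hE : IsRegular b E) : ∑ i, (#(rowSet E i) - b) ≤ n - b := by
  rw [← Finset.sum_filter_of_ne (p := fun i => b ≤ #(rowSet E i)) fun i _ h => by omega]
  rcases (univ.filter fun i => b ≤ #(rowSet E i)).eq_empty_or_nonempty with h | h
  · rw [h]; simp
  · have h1 := hE.sum_card_rowSet_le h (by simp)
    have h2 := card_le_univ ((univ.filter fun i => b ≤ #(rowSet E i)).biUnion (rowSet E))
    rw [Fintype.card_fin] at h2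
    omega

/-- Over some extension field, suitable row parity checks correct a regular pattern. -/
theorem IsRegular.exists_corrects {m n b : ℕ} {E : Finset (Fin m × Fin n)} (hE : IsRegular b E)
    (F : Type u) [Field F] :
    ∃ (K : Type u) (_ : Field K) (_ : Algebra F K) (β : Fin b → Fin n → K),
      Corrects (sumCode β) E := by
  classical
  have hN := hE.sum_card_rowSet_univ_le
  set N := ∑ i, (#(rowSet E i) - b) with hNdef
  -- Block i has as many rows as an MDS code of dimension n - b has dimensions of words supported on
  -- `rowSet E i`; truncated subtraction makes it empty when fewer than b entries are erased. The
  -- last summand fills up to n - b rows, without support restriction.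
  let ι := (Σ i : Fin m, Fin (#(rowSet E i) - b)) ⊕ Fin (n - b - N)
  have hι : Fintype.card ι = n - b := by
    simp only [ι, Fintype.card_sum, Fintype.card_sigma, Fintype.card_fin]
    omega
  let T : ι → Finset (Fin n) := Sum.elim (fun p => rowSet E p.1) fun _ => univ
  obtain ⟨K, _, _, G, hG0, hG⟩ := exists_matrix_maximal_minors_ne_zero F T b
    (by rw [hι, Fintype.card_fin]; omega) (by
      intro I hI
      by_cases hr : ∃ s, Sum.inr s ∈ I
      · obtain ⟨s, hs⟩ := hr
        have h1 : univ ⊆ I.biUnion T := fun j _ => mem_biUnion.2 ⟨_, hs, by simp [T]⟩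
        have h2 := card_le_card h1
        have h3 := card_le_univ I
        have h4 := s.2
        rw [hι] at h3
        simp only [card_univ, Fintype.card_fin] at h2
        omega
      · push Not at hr
        let U : Finset (Fin m) := univ.filter fun i => ∃ s, Sum.inl ⟨i, s⟩ ∈ I
        have hU : U.Nonempty := by
          obtain ⟨r | r, hrI⟩ := hI
          · exact ⟨r.1, by simpa [U] using ⟨r.2, hrI⟩⟩
          · exact absurd hrI (hr r)
        have hUb : ∀ i ∈ U, b ≤ #(rowSet E i) := fun i hi => by
          obtain ⟨s, -⟩ := (mem_filter.1 hi).2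
          have := s.2
          omega
        have h1 := hE.sum_card_rowSet_le hU hUb
        have h2 : U.biUnion (rowSet E) ⊆ I.biUnion T := by
          intro j hj
          obtain ⟨i, hi, hij⟩ := mem_biUnion.1 hj
          obtain ⟨s, hs⟩ := (mem_filter.1 hi).2
          exact mem_biUnion.2 ⟨_, hs, hij⟩
        have h3 : I ⊆ (U.sigma fun i => (univ : Finset (Fin (#(rowSet E i) - b)))).image
            Sum.inl := by
          rintro (r | r) hrI
          · exact mem_image.2 ⟨r, by simpa [U] using ⟨r.2, hrI⟩, rfl⟩
          · exact absurd hrI (hr r)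
        have h4 := (card_le_card h3).trans card_image_le
        rw [card_sigma] at h4
        simp only [card_univ, Fintype.card_fin] at h4
        have h5 := card_le_card h2
        omega)
  have hcard : Fintype.card ι ≤ Fintype.card (Fin n) := by rw [hι, Fintype.card_fin]; omega
  have hinj : ∀ x : ι → K, Matrix.vecMul x G = 0 → x = 0 := fun x hx => funext fun r =>
    eq_zero_of_vecMul_eq_zero_off G hG hcard ∅ ∅ (by simp) (by simpa using hcard) x
      (by simp [hx]) r (by simp)
  have hrank : finrank K (LinearMap.range G.vecMulLinear) = n - b := by
    rw [LinearMap.finrank_range_of_inj, finrank_fintype_fun_eq_card, hι]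
    rw [← LinearMap.ker_eq_bot, LinearMap.ker_eq_bot']
    exact hinj
  obtain ⟨β, hβ⟩ := exists_parity_checks (b := b) (LinearMap.range G.vecMulLinear)
    (by rw [hrank]; omega)
  refine ⟨K, inferInstance, inferInstance, β, corrects_iff.2 fun c hc hcE => ?_⟩
  rw [mem_sumCode] at hc
  choose x hx using fun i => hβ (c i) fun k => hc.2 k i
  have hx' : ∀ i, Matrix.vecMul (x i) G = c i := hx
  let B : Fin m → Finset ι := fun i => univ.image fun s => Sum.inl ⟨i, s⟩
  -- Row i of the codeword vanishes outside its erased set, so it uses only generators in block i.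
  have hxB : ∀ i, ∀ r ∉ B i, x i r = 0 := by
    intro i
    refine eq_zero_of_vecMul_eq_zero_off G hG hcard (rowSet E i) (B i) ?_ ?_ (x i) ?_
    · intro r hr j hj
      obtain ⟨s, -, rfl⟩ := mem_image.1 hr
      exact hG0 _ _ hj
    · have h1 : #(B i) = #(rowSet E i) - b := by
        rw [card_image_of_injective, card_univ, Fintype.card_fin]
        intro s t hst
        exact eq_of_heq (Sigma.mk.inj (Sum.inl_injective hst)).2
      have h2 := card_le_univ (rowSet E i)
      rw [Fintype.card_fin] at h2 ⊢
      omega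
    · intro j hj
      rw [hx']
      exact hcE i j (by simpa [mem_rowSet] using hj)
  have hsum : ∑ i, x i = 0 := by
    refine hinj _ ?_
    change G.vecMulLinear _ = 0
    rw [map_sum]
    ext j
    rw [Finset.sum_apply]
    simpa [hx'] using hc.1 j
  -- The blocks are disjoint, so the vanishing of the sum forces each term to vanish.
  have hx0 : ∀ i, x i = 0 := by
    intro i
    ext r
    by_cases hr : r ∈ B i
    · have h1 := congrFun hsum r
      rw [Finset.sum_apply, Finset.sum_eq_single i] at h1
      · exact h1
      · intro i' _ hi'
        refine hxB i' r fun hr' => hi' ?_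
        obtain ⟨s, -, rfl⟩ := mem_image.1 hr
        obtain ⟨s', -, hs'⟩ := mem_image.1 hr'
        simpa using congrArg (Sum.elim Sigma.fst fun _ => i') hs'
      · simp
    · exact hxB i r hr
  ext i j
  rw [← hx' i, hx0 i, Matrix.zero_vecMul]
  rfl

/-! ### Correction as nonvanishing of a minor -/

theorem exists_submatrix_det_ne_zero {K ρ ε : Type*} [Field K] [Fintype ρ] [Fintype ε]
    [DecidableEq ε] (A : Matrix ρ ε K) (hA : ∀ v, A.mulVec v = 0 → v = 0) :
    ∃ s : ε → ρ, (A.submatrix s id).det ≠ 0 := by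
  classical
  have hinj : Function.Injective A.mulVecLin := by
    rw [← LinearMap.ker_eq_bot, LinearMap.ker_eq_bot']
    exact hA
  have hrank : finrank K (Submodule.span K (Set.range A.row)) = Fintype.card ε := by
    rw [← Matrix.rank_eq_finrank_span_row, Matrix.rank, LinearMap.finrank_range_of_inj hinj,
      finrank_fintype_fun_eq_card]
  obtain ⟨κ, a, ha, hspan, hli⟩ := exists_linearIndependent' K A.row
  have : Finite κ := Finite.of_injective a ha
  have := Fintype.ofFinite κ
  have hcard : Fintype.card ε = Fintype.card κ := by
    rw [← hrank, ← hspan, finrank_span_eq_card hli]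
  let e : ε ≃ κ := Fintype.equivOfCardEq hcard
  refine ⟨a ∘ e, fun h0 => ?_⟩
  have hli' : LinearIndependent K (A.submatrix (a ∘ e) id).row := hli.comp e e.injective
  rw [Matrix.linearIndependent_rows_iff_isUnit, Matrix.isUnit_iff_isUnit_det, h0] at hli'
  exact not_isUnit_zero hli'

/-- The parity check matrix of `sumCode β`, restricted to the positions in `E`. -/
def parityMatrix {R : Type*} [CommRing R] {m n b : ℕ} (β : Fin b → Fin n → R)
    (E : Finset (Fin m × Fin n)) : Matrix (Fin n ⊕ Fin m × Fin b) E R :=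
  Matrix.of fun r e => Sum.elim (fun j => if e.1.2 = j then 1 else 0)
    (fun p => if e.1.1 = p.1 then β p.2 e.1.2 else 0) r

theorem parityMatrix_map {R S : Type*} [CommRing R] [CommRing S] {m n b : ℕ}
    (β : Fin b → Fin n → R) (E : Finset (Fin m × Fin n)) (f : R →+* S) :
    (parityMatrix β E).map f = parityMatrix (fun k j => f (β k j)) E := by
  ext r e
  rcases r with j | p <;> simp [parityMatrix, apply_ite f]

theorem corrects_sumCode_iff {K : Type*} [Field K] {m n b : ℕ} {β : Fin b → Fin n → K}
    {E : Finset (Fin m × Fin n)} :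
    Corrects (sumCode β) E ↔ ∀ v, (parityMatrix β E).mulVec v = 0 → v = 0 := by
  classical
  have key : ∀ c : Matrix (Fin m) (Fin n) K, (∀ i j, (i, j) ∉ E → c i j = 0) →
      (c ∈ sumCode β ↔ (parityMatrix β E).mulVec (fun e => c e.1.1 e.1.2) = 0) := by
    intro c hc
    have h1 : ∀ f : Fin m × Fin n → K,
        ∑ e : E, f e.1 * c e.1.1 e.1.2 = ∑ i, ∑ j, f (i, j) * c i j := by
      intro f
      rw [Finset.sum_coe_sort E (fun e => f e * c e.1 e.2), ← Fintype.sum_prod_type']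
      refine Finset.sum_subset (subset_univ _) fun e _ he => ?_
      rw [hc e.1 e.2 he, mul_zero]
    have hl : ∀ j, (parityMatrix β E).mulVec (fun e => c e.1.1 e.1.2) (Sum.inl j)
        = ∑ i, c i j := by
      intro j
      refine (h1 fun e => if e.2 = j then 1 else 0).trans ?_
      simp
    have hr : ∀ p : Fin m × Fin b, (parityMatrix β E).mulVec (fun e => c e.1.1 e.1.2) (Sum.inr p)
        = ∑ j, β p.2 j * c p.1 j := by
      intro p
      refine (h1 fun e => if e.1 = p.1 then β p.2 e.2 else 0).trans ?_
      rw [Finset.sum_comm]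
      simp
    rw [mem_sumCode, funext_iff, Sum.forall]
    simp only [hl, hr, Pi.zero_apply, Prod.forall]
    rw [forall_comm (α := Fin m)]
  rw [corrects_iff]
  constructor
  · intro H v hv
    let c : Matrix (Fin m) (Fin n) K := fun i j => if h : (i, j) ∈ E then v ⟨(i, j), h⟩ else 0
    have hcE : ∀ i j, (i, j) ∉ E → c i j = 0 := fun i j h => dif_neg h
    have hcv : (fun e : E => c e.1.1 e.1.2) = v := funext fun e => dif_pos e.2
    have h0 := H c ((key c hcE).2 (by rw [hcv, hv])) hcE
    rw [← hcv, h0]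
    rfl
  · intro H c hc hcE
    have h0 := H _ ((key c hcE).1 hc)
    ext i j
    by_cases h : (i, j) ∈ E
    · exact congrFun h0 ⟨(i, j), h⟩
    · exact hcE i j h

/-- A nonzero polynomial of low degree in the row parity checks `β` whose nonvanishing ensures
that a given regular pattern is corrected. -/
theorem IsRegular.exists_polynomial {m n b : ℕ} {E : Finset (Fin m × Fin n)} (hE : IsRegular b E)
    (F : Type u) [Field F] :
    ∃ p : MvPolynomial (Fin b × Fin n) F, p ≠ 0 ∧ (∀ v, p.degreeOf v ≤ m) ∧
      ∀ x : Fin b × Fin n → F, MvPolynomial.eval x p ≠ 0 →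
        Corrects (sumCode fun k j => x (k, j)) E := by
  classical
  obtain ⟨K, _, _, β, hβ⟩ := hE.exists_corrects F
  obtain ⟨s, hs⟩ := exists_submatrix_det_ne_zero _ (corrects_sumCode_iff.1 hβ)
  let P : Matrix (Fin n ⊕ Fin m × Fin b) E (MvPolynomial (Fin b × Fin n) F) :=
    parityMatrix (fun k j => MvPolynomial.X (k, j)) E
  have hmap : ∀ {S : Type u} [Field S] (f : MvPolynomial (Fin b × Fin n) F →+* S),
      f (P.submatrix s id).det =
        ((parityMatrix (fun k j => f (MvPolynomial.X (k, j))) E).submatrix s id).det := by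
    intro S _ f
    rw [RingHom.map_det, RingHom.mapMatrix_apply, ← Matrix.submatrix_map, parityMatrix_map]
  refine ⟨(P.submatrix s id).det, fun h0 => hs ?_, fun v => ?_, fun x hx => ?_⟩
  -- The point β over K serves only to show that the minor, a polynomial over F, is nonzero.
  · have h1 := hmap (MvPolynomial.aeval fun p : Fin b × Fin n => β p.1 p.2).toRingHom
    rw [h0, map_zero] at h1
    simpa using h1.symm
  · rw [Matrix.det_apply]
    refine (MvPolynomial.degreeOf_sum_le _ _ _).trans (Finset.sup_le fun σ _ => ?_)
    have h1 : ∀ q : MvPolynomial (Fin b × Fin n) F,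
        (Equiv.Perm.sign σ • q).degreeOf v ≤ q.degreeOf v := by
      intro q
      rcases Int.units_eq_one_or (Equiv.Perm.sign σ) with h | h <;> simp [h]
    refine (h1 _).trans ((MvPolynomial.degreeOf_prod_le _ _ _).trans ?_)
    -- The variable (k, j) occurs only in matrix columns indexed by cells of array column j, of
    -- which there are at most m, and to degree at most 1 in each.
    have h2 : ∀ e : E, ((P.submatrix s id) (σ e) e).degreeOf v ≤ if e.1.2 = v.2 then 1 else 0 := by
      intro e
      simp only [P, parityMatrix, Matrix.submatrix_apply, Matrix.of_apply, id]
      rcases s (σ e) with j | p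
      · simp only [Sum.elim_inl]
        split_ifs <;> simp
      · simp only [Sum.elim_inr]
        by_cases hp : e.1.1 = p.1
        · rw [if_pos hp, MvPolynomial.degreeOf_X]
          by_cases hv : v = (p.2, e.1.2)
          · simp [hv]
          · simp [hv]
        · simp [hp]
    refine (Finset.sum_le_sum fun e _ => h2 e).trans ?_
    rw [Finset.sum_coe_sort E (fun e => if e.2 = v.2 then 1 else 0), ← Finset.card_filter]
    refine (Finset.card_le_card_of_injOn (t := univ) Prod.fst (fun _ _ => mem_univ _) ?_).trans
      (by simp)
    intro e he e' he' h
    have h3 := (mem_filter.1 he).2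
    have h4 := (mem_filter.1 he').2
    exact Prod.ext h (h3.trans h4.symm)
  · rw [corrects_sumCode_iff]
    intro v hv
    have h1 := hmap (MvPolynomial.eval x)
    rw [h1] at hx
    simp only [MvPolynomial.eval_X] at hx
    refine Matrix.eq_zero_of_mulVec_eq_zero hx ?_
    ext e
    exact congrFun hv (s e)

/-! ### Small supports and the choice of row checks -/

/-- The support of a nonzero word of a code with zero column sums, if correctable, is the image of
a small pattern on few columns. -/
theorem exists_small_pattern {m n b : ℕ} {E : Finset (Fin m × Fin n)} (hE : IsRegular b E)
    (hne : E.Nonempty)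
    (hcol : ∀ e ∈ E, ∃ i, i ≠ e.1 ∧ (i, e.2) ∈ E) :
    ∃ (f : Fin (b * (m - 1)) → Fin n) (S : Finset (Fin m × Fin (b * (m - 1)))),
      #S ≤ 2 * b * (m - 1) ∧ S.image (Prod.map id f) = E := by
  classical
  obtain ⟨e₀, he₀⟩ := hne
  obtain ⟨i₀, hi₀, hi₀E⟩ := hcol e₀ he₀
  let V := E.image Prod.snd
  have hm : 2 ≤ m := by
    have h1 := i₀.2
    have h2 := e₀.1.2
    have h3 : i₀.1 ≠ e₀.1.1 := fun h => hi₀ (Fin.ext h)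
    omega
  have hV0 : 1 ≤ #V := card_pos.2 ⟨_, mem_image_of_mem _ he₀⟩
  have hEV : E ⊆ univ ×ˢ V := fun e he =>
    mem_product.2 ⟨mem_univ _, mem_image_of_mem Prod.snd he⟩
  have h2V : 2 * #V ≤ #E := by
    rw [Finset.card_eq_sum_card_image Prod.snd E, mul_comm, ← smul_eq_mul]
    refine Finset.card_nsmul_le_sum _ _ _ fun j hj => ?_
    obtain ⟨e, he, rfl⟩ := mem_image.1 hj
    obtain ⟨i, hi, hiE⟩ := hcol e he
    refine Nat.succ_le_of_lt (one_lt_card.2 ⟨e, by simp [he], (i, e.2), by simp [hiE], ?_⟩)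
    exact fun h => hi (congrArg Prod.fst h).symm
  obtain ⟨l, rfl⟩ := Nat.exists_eq_add_of_le hm
  have hl : 2 + l - 1 = l + 1 := by omega
  have hbound : #V ≤ b * (2 + l - 1) ∧ #E ≤ 2 * b * (2 + l - 1) := by
    rw [hl]
    -- If b ≤ #V, then 2#V ≤ #E ≤ #V + b(m-1) by regularity. Otherwise #V < b, and #E ≤ m#V suffices
    -- since m ≥ 2.
    by_cases hb : b ≤ #V
    · have h1 := hE univ V ⟨e₀.1, mem_univ _⟩ hb
      rw [inter_eq_left.2 hEV, card_univ, Fintype.card_fin] at h1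
      constructor <;> nlinarith
    · have h1 := card_le_card hEV
      rw [card_product, card_univ, Fintype.card_fin] at h1
      constructor <;> nlinarith
  obtain ⟨g⟩ : Nonempty (V ↪ Fin (b * (2 + l - 1))) :=
    Function.Embedding.nonempty_of_card_le (by simpa using hbound.1)
  have : Nonempty V := ⟨⟨_, mem_image_of_mem _ he₀⟩⟩
  let f : Fin (b * (2 + l - 1)) → Fin n := fun t => (Function.invFun g t : V)
  have hf : ∀ v : V, f (g v) = v := fun v => by simp [f, Function.leftInverse_invFun g.injective v]
  refine ⟨f, E.attach.image fun e => (e.1.1, g ⟨e.1.2, mem_image_of_mem _ e.2⟩), ?_, ?_⟩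
  · exact card_image_le.trans (by rw [card_attach]; exact hbound.2)
  · rw [image_image]
    conv_rhs => rw [← attach_image_val (s := E)]
    refine image_congr fun e _ => ?_
    simp [hf]

theorem card_filter_card_le {α : Type*} [Fintype α] [DecidableEq α] (r : ℕ) :
    #(univ.filter fun S : Finset α => #S ≤ r) ≤ binomLE (Fintype.card α) r := by
  have h : (univ.filter fun S : Finset α => #S ≤ r) ⊆
      (range (r + 1)).biUnion fun i => powersetCard i univ := fun S hS => by
    simpa [Nat.lt_succ_iff] using hS
  refine (card_le_card h).trans (card_biUnion_le.trans ?_)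
  simp [binomLE, card_powersetCard]

theorem exists_eval_ne_zero {F σ : Type*} [Field F] [Finite F] [Finite σ] {p : MvPolynomial σ F}
    (hp : p ≠ 0) (hdeg : ∀ v, p.degreeOf v < Nat.card F) : ∃ x, MvPolynomial.eval x p ≠ 0 := by
  classical
  have := Fintype.ofFinite F
  by_contra! h
  refine hp (MvPolynomial.eq_zero_of_eval_zero_at_prod_finset p (fun _ => univ) (fun v => ?_)
    fun x _ => h x)
  simpa using hdeg v

theorem exists_isMR {m n b : ℕ} (hn : 1 ≤ n)
    (F : Type*) [Field F] [Finite F]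
    (hq : C₀ m b * n ^ (2 * b * (m - 1)) + n ^ (b - 1) ≤ Nat.card F) :
    ∃ C : Submodule F (Matrix (Fin m) (Fin n) F), IsMR 1 b 0 C := by
  classical
  have hpoly : ∀ E : Finset (Fin m × Fin n), ∃ p : MvPolynomial (Fin b × Fin n) F,
      p ≠ 0 ∧ (∀ v, p.degreeOf v ≤ m) ∧ (IsRegular b E → ∀ x : Fin b × Fin n → F,
        MvPolynomial.eval x p ≠ 0 → Corrects (sumCode fun k j => x (k, j)) E) := by
    intro E
    by_cases hE : IsRegular b E
    · obtain ⟨p, h1, h2, h3⟩ := hE.exists_polynomial F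
      exact ⟨p, h1, h2, fun _ => h3⟩
    · exact ⟨1, one_ne_zero, by simp, fun h => absurd h hE⟩
  choose p hp0 hpdeg hp using hpoly
  let Q : Finset ((Fin (b * (m - 1)) → Fin n) × Finset (Fin m × Fin (b * (m - 1)))) :=
    univ ×ˢ univ.filter fun S => #S ≤ 2 * b * (m - 1)
  have hQ : #Q ≤ n ^ (b * (m - 1)) * binomLE (m * (b * (m - 1))) (2 * b * (m - 1)) := by
    rw [card_product]
    have h := card_filter_card_le (α := Fin m × Fin (b * (m - 1))) (2 * b * (m - 1))
    rw [Fintype.card_prod, Fintype.card_fin, Fintype.card_fin] at h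
    exact Nat.mul_le_mul (by simp) h
  -- The index set consists of pairs (f, S), with f not necessarily injective; patterns that are not
  -- regular contribute the factor 1.
  obtain ⟨x, hx⟩ := exists_eval_ne_zero
    (p := ∏ t ∈ Q, p (t.2.image (Prod.map id t.1))) (Finset.prod_ne_zero_iff.2 fun t _ => hp0 _)
    (by
      intro v
      refine lt_of_lt_of_le ?_ hq
      have h1 := (MvPolynomial.degreeOf_prod_le v Q _).trans
        (Finset.sum_le_card_nsmul Q _ m fun t _ => hpdeg (t.2.image (Prod.map id t.1)) v)
      have h2 : #Q • m ≤ C₀ m b * n ^ (2 * b * (m - 1)) := by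
        calc #Q * m ≤ (n ^ (b * (m - 1)) * binomLE (m * (b * (m - 1))) (2 * b * (m - 1))) * m :=
              Nat.mul_le_mul_right _ hQ
          _ = (m * binomLE (m * (b * (m - 1))) (2 * b * (m - 1))) * n ^ (b * (m - 1)) := by ring
          _ ≤ C₀ m b * n ^ (2 * b * (m - 1)) := by
              refine Nat.mul_le_mul (Nat.mul_le_mul_right _ ?_) (Nat.pow_le_pow_right hn ?_)
              · exact (Nat.le_succ m).trans (Nat.self_le_factorial _)
              · rw [mul_assoc]; omega
      -- The summand n^(b-1) is needed only to make the degree bound strict.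
      have h3 : 0 < n ^ (b - 1) := pow_pos hn _
      omega)
  refine ⟨sumCode fun k j => x (k, j), ⟨_, _, _, rfl⟩, fun E hE =>
    corrects_iff.2 fun c hc hcE => ?_⟩
  rw [map_prod, Finset.prod_ne_zero_iff] at hx
  by_contra hc0
  let S : Finset (Fin m × Fin n) := univ.filter fun e => c e.1 e.2 ≠ 0
  have hSE : S ⊆ E := fun e he => by
    by_contra h
    exact (mem_filter.1 he).2 (hcE e.1 e.2 h)
  have hS : IsRegular b S := (hE.mono hSE).isRegular
  have hSne : S.Nonempty := by
    by_contra h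
    refine hc0 (Matrix.ext fun i j => ?_)
    by_contra hij
    exact h ⟨(i, j), by simpa [S] using hij⟩
  have hcol : ∀ e ∈ S, ∃ i, i ≠ e.1 ∧ (i, e.2) ∈ S := by
    intro e he
    by_contra! h
    refine (mem_filter.1 he).2 ?_
    rw [← (mem_sumCode.1 hc).1 e.2, Finset.sum_eq_single e.1 (fun i _ hi => ?_) (by simp)]
    by_contra h0
    exact h i hi (by simpa [S] using h0)
  obtain ⟨f, S', hS', hfS⟩ := exists_small_pattern hS hSne hcol
  have h1 := hx (f, S') (by simpa [Q] using hS')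
  rw [hfS] at h1
  exact hc0 (corrects_iff.1 (hp S hS x h1) c hc fun i j hij => by simpa [S] using hij)

end GridTopology

theorem mainTheorem1 (m n b : ℕ) (hm : 1 ≤ m) (hn : 1 ≤ n) (hb : 1 ≤ b)
    (F : Type*) [Field F] [Finite F]
    (hq : GridTopology.C₀ m b * n ^ (2 * b * (m - 1)) + n ^ (b - 1) ≤ Nat.card F) :
    ∃ C : Submodule F (Matrix (Fin m) (Fin n) F), GridTopology.IsMR 1 b 0 C :=
  GridTopology.exists_isMR hn F hq
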